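/- A Euclidean Jordan algebra is a finite-dimensional real inner product space $V$ with a bilinear commutative product having a unit $e$ and satisfying $x^2(xy)=x(x^2y)$ and $\langle xy,z\rangle=\langle y,xz\rangle$ for all $x,y,z\in V$. It is simple if $V\neq\{0\}$ and its only ideals are $\{0\}$ and $V$. Its rank is the maximum over $x\in V$ of the least $k$ for which $e,x,\dots,x^k$ are linearly dependent. Let $Q=\{x^2:x\in V\}$ be its cone of squares. For a closed convex cone $K$ in a Euclidean space $E$, write $x\sqcap_K y=P_{x-K}\,y$ and $x\sqcup_K y=P_{x+K}\,y$, where $P_D$ is the nearest-point projection onto the nonempty closed convex set $D$. A set $M\subset E$ is lattice-like in $(E,K)$ if $x\sqcap_K y\in M$ and $x\sqcup_K y\in M$ for all $x,y\in M$. Theorem. Let $V$ be a simple Euclidean Jordan algebra of rank at least $3$ with cone of squares $Q$. Then there is no closed convex lattice-like set $C\subsetneq V$ in $(V,Q)$ with nonempty interior. In particular, for every $n\ge 3$, the space of real symmetric $n\times n$ matrices with the inner product $\langle A,B\rangle=\operatorname{tr}(AB)$, ordered by the cone of positive semidefinite matrices, contains no proper closed convex lattice-like set with nonempty interior. -/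

import Mathlib

noncomputable section

/-- A Euclidean Jordan algebra: a finite-dimensional real inner product space with a bilinear
commutative product that satisfies the Jordan identity `(x y) (x x) = x (y (x x))` (contained in
`IsCommJordan`), has a unit, and for which the inner product is associative. -/
class EuclideanJordanAlgebra (V : Type*) [NormedAddCommGroup V] [InnerProductSpace ℝ V]
    [FiniteDimensional ℝ V] extends CommMagma V, IsCommJordan V, One V where
  add_mul : ∀ x y z : V, (x + y) * z = x * z + y * z
  smul_mul : ∀ (t : ℝ) (x y : V), (t • x) * y = t • (x * y)
  one_mul : ∀ x : V, 1 * x = x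
  inner_mul : ∀ x y z : V, inner ℝ (x * y) z = inner ℝ y (x * z)

namespace EuclideanJordanAlgebra

section

variable {V : Type*} [NormedAddCommGroup V] [InnerProductSpace ℝ V] [FiniteDimensional ℝ V]
  [EuclideanJordanAlgebra V]

/-- The powers `x ^ 0 = e`, `x ^ (k + 1) = x (x ^ k)`. -/
def power (x : V) : ℕ → V
  | 0 => 1
  | k + 1 => x * power x k

/-- The degree of the minimal polynomial of `x`: the least `k` such that
`e, x, …, x ^ k` are linearly dependent. -/
def degree (x : V) : ℕ :=
  sInf {k : ℕ | ¬ LinearIndependent ℝ (fun i : Fin (k + 1) => power x i)}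

variable (V)

/-- The rank: the largest degree of the minimal polynomial of an element. -/
def rank : ℕ := ⨆ x : V, degree x

/-- The algebra is nonzero and has no ideals besides `0` and the whole algebra. -/
def IsSimple : Prop :=
  Nontrivial V ∧
    ∀ I : Submodule ℝ V, (∀ x : V, ∀ y ∈ I, x * y ∈ I) → I = ⊥ ∨ I = ⊤

/-- The cone of squares `Q`. -/
def squareCone : Set V := Set.range fun x : V => x * x

end

end EuclideanJordanAlgebra

section

variable {E : Type*} [NormedAddCommGroup E]

/-- The metric projection onto `D`: the (unique, if `D` is nonempty, closed and convex in a
Euclidean space) point of `D` nearest to `x`. -/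
def nearestPoint (D : Set E) (x : E) : E :=
  Classical.epsilon fun p => p ∈ D ∧ ‖x - p‖ = ⨅ y : D, ‖x - y‖

/-- The operation `x ⊓_K y = P_{x - K} y`. -/
def coneInf (K : Set E) (x y : E) : E := nearestPoint ((fun k => x - k) '' K) y

/-- The operation `x ⊔_K y = P_{x + K} y`. -/
def coneSup (K : Set E) (x y : E) : E := nearestPoint ((fun k => x + k) '' K) y

/-- `M` is invariant with respect to both operations `⊓_K` and `⊔_K`. -/
def IsLatticeLike (K M : Set E) : Prop :=
  ∀ x ∈ M, ∀ y ∈ M, coneInf K x y ∈ M ∧ coneSup K x y ∈ M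

end

/-- The linear subspace of symmetric real `n × n` matrices. -/
def symmSubmodule (n : ℕ) : Submodule ℝ (Matrix (Fin n) (Fin n) ℝ) where
  carrier := {A | A.IsSymm}
  add_mem' := fun hA hB => hA.add hB
  zero_mem' := Matrix.isSymm_zero
  smul_mem' := fun c _ hA => hA.smul c

/-- The space of symmetric real `n × n` matrices; below it is given the trace inner product. -/
def SymmMatrix (n : ℕ) : Type := symmSubmodule n

namespace SymmMatrix

variable {n : ℕ}

instance : AddCommGroup (SymmMatrix n) := inferInstanceAs (AddCommGroup (symmSubmodule n))

instance : Module ℝ (SymmMatrix n) := inferInstanceAs (Module ℝ (symmSubmodule n))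

/-- The underlying matrix. -/
def toMatrix (A : SymmMatrix n) : Matrix (Fin n) (Fin n) ℝ := A.1

/-- The inner product `⟨A, B⟩ = tr (A B)`. -/
@[reducible] def innerCore (n : ℕ) : InnerProductSpace.Core ℝ (SymmMatrix n) where
  inner A B := (A.toMatrix * B.toMatrix).trace
  conj_inner_symm A B := by
    simpa using Matrix.trace_mul_comm B.toMatrix A.toMatrix
  re_inner_nonneg A := by
    have h : A.toMatrix.transpose = A.toMatrix := A.2
    have h2 : (A.toMatrix * A.toMatrix).trace = ∑ i, ∑ j, A.toMatrix i j ^ 2 := by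
      have hs : ∀ i j, A.toMatrix j i = A.toMatrix i j := fun i j => congrFun (congrFun h i) j
      simp [Matrix.trace, Matrix.mul_apply, pow_two, hs]
    simp only [h2, RCLike.re_to_real]
    positivity
  add_left A B C := by
    change ((A.toMatrix + B.toMatrix) * C.toMatrix).trace = _
    rw [Matrix.add_mul, Matrix.trace_add]
  smul_left A B r := by
    change ((r • A.toMatrix) * B.toMatrix).trace = _
    simp
  definite A hA := by
    have h : A.toMatrix.conjTranspose = A.toMatrix := by
      rw [Matrix.conjTranspose_eq_transpose_of_trivial]
      exact A.2
    have h0 : (A.toMatrix.conjTranspose * A.toMatrix).trace = 0 := by rw [h]; exact hA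
    exact Subtype.ext (Matrix.trace_conjTranspose_mul_self_eq_zero_iff.1 h0)

instance : NormedAddCommGroup (SymmMatrix n) := (innerCore n).toNormedAddCommGroup

instance : InnerProductSpace ℝ (SymmMatrix n) := InnerProductSpace.ofCore (innerCore n).toCore

/-- The cone of positive semidefinite matrices. -/
def psdCone (n : ℕ) : Set (SymmMatrix n) := {A | A.toMatrix.PosSemidef}

end SymmMatrix

end

noncomputable section

open Filter Topology

/-! ### Projections onto translated cones and the normal of a lattice-like body -/

section Projection

variable {E : Type*} [NormedAddCommGroup E]

/-! Inscribe in `C` a ball that touches a supporting hyperplane with unit normal `u`. Suppose `x`,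
`y` are orthogonal vectors of a self-dual cone on which `u` has the same strict sign. Some
combination `d` of `x` and `-y` with positive coefficients is tangent to the hyperplane. Near the
point of contact a segment of length of order `s` in direction `d` fits into the ball at depth of
order `s ^ 2`. The operations applied to its endpoints move the initial point by multiples of `x`
and of `-y` of order `s`, and one of these moves crosses the hyperplane. Hence `⟪u, x⟫ ⟪u, y⟫ ≤ 0`
for all orthogonal `x`, `y` in the cone (`IsLatticeLike.exists_normal`); what remains is algebra
about `u`.

In a Jordan algebra the Moreau decomposition strengthens this to `⟪u, x⟫ ⟪u, y⟫ ≤ ‖u‖ ^ 2 ⟪x, y⟫` on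
the whole cone (`inner_mul_inner_le_of_orthogonal`). Testing spectral idempotents leaves `u` at most
one positive and one negative eigenvalue, so `u = a p + b q` with `p + q + f = 1`. Perturbed squares
show that no Peirce space joins `f` to `p` or `q` (`half_eq_zero`), so simplicity forces `f = 0`.
The same sign argument shows that `p` and `q` do not split further, so every element satisfies a
quadratic equation and the rank is at most 2.

For symmetric matrices, rank-one matrices of orthogonal vectors already suffice to show that `u =
0`. -/

theorem nearestPoint_eq {D : Set E} {x p : E} (hp : p ∈ D) (hmin : ∀ q ∈ D, ‖x - p‖ ≤ ‖x - q‖)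
    (huniq : ∀ q ∈ D, ‖x - q‖ ≤ ‖x - p‖ → q = p) : nearestPoint D x = p := by
  have hinf : ‖x - p‖ = ⨅ y : D, ‖x - y‖ := by
    have : Nonempty D := ⟨⟨p, hp⟩⟩
    refine le_antisymm (le_ciInf fun y => hmin y y.2) ?_
    exact ciInf_le ⟨0, by rintro _ ⟨y, rfl⟩; exact norm_nonneg _⟩ (⟨p, hp⟩ : D)
  have h := Classical.epsilon_spec (p := fun p => p ∈ D ∧ ‖x - p‖ = ⨅ y : D, ‖x - y‖) ⟨p, hp, hinf⟩
  exact huniq _ h.1 (h.2.trans hinf.symm).le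

variable [InnerProductSpace ℝ E]

/-- Expanding `‖(x - k) - y‖ ^ 2` leaves `‖x - k‖ ^ 2 + 2 ⟪k, y⟫ + ‖y‖ ^ 2`. This is the variational
half of Moreau's theorem: `x` is the projection of `x - y` onto the cone. -/
theorem norm_sub_le_and_unique {x y k : E} (hxy : inner ℝ x y = 0) (hk : 0 ≤ inner ℝ k y) :
    ‖y‖ ≤ ‖x - y - k‖ ∧ (‖x - y - k‖ ≤ ‖y‖ → k = x) := by
  have h : ‖x - y - k‖ ^ 2 = ‖x - k‖ ^ 2 + 2 * inner ℝ k y + ‖y‖ ^ 2 := by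
    have : x - y - k = (x - k) - y := by abel
    rw [this, norm_sub_sq_real, inner_sub_left, hxy]
    ring
  constructor
  · refine (pow_le_pow_iff_left₀ (norm_nonneg _) (norm_nonneg _) two_ne_zero).1 ?_
    nlinarith [sq_nonneg ‖x - k‖]
  · intro hle
    have h2 : ‖x - y - k‖ ^ 2 ≤ ‖y‖ ^ 2 := by gcongr
    have h3 : ‖x - k‖ ^ 2 = 0 := le_antisymm (by nlinarith) (sq_nonneg _)
    exact (sub_eq_zero.1 (norm_eq_zero.1 (pow_eq_zero_iff two_ne_zero |>.1 h3))).symm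

theorem coneSup_add_sub {K : Set E} {p x y : E} (hx : x ∈ K) (hxy : inner ℝ x y = 0)
    (hK : ∀ k ∈ K, 0 ≤ inner ℝ k y) : coneSup K p (p + (x - y)) = p + x := by
  refine nearestPoint_eq ⟨x, hx, rfl⟩ ?_ ?_
  · rintro _ ⟨k, hk, rfl⟩
    have e1 : p + (x - y) - (p + x) = -y := by abel
    have e2 : p + (x - y) - (p + k) = x - y - k := by abel
    simpa only [e1, e2, norm_neg] using (norm_sub_le_and_unique hxy (hK k hk)).1
  · rintro _ ⟨k, hk, rfl⟩ h
    have e1 : p + (x - y) - (p + x) = -y := by abel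
    have e2 : p + (x - y) - (p + k) = x - y - k := by abel
    simp only [e1, e2, norm_neg] at h
    simp only [(norm_sub_le_and_unique hxy (hK k hk)).2 h]

theorem coneInf_add_sub {K : Set E} {p x y : E} (hy : y ∈ K) (hxy : inner ℝ x y = 0)
    (hK : ∀ k ∈ K, 0 ≤ inner ℝ k x) : coneInf K p (p + (x - y)) = p - y := by
  have hyx : inner ℝ y x = 0 := by rw [real_inner_comm, hxy]
  refine nearestPoint_eq ⟨y, hy, rfl⟩ ?_ ?_
  · rintro _ ⟨k, hk, rfl⟩
    have e1 : p + (x - y) - (p - y) = x := by abel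
    have e2 : p + (x - y) - (p - k) = -(y - x - k) := by abel
    simpa only [e1, e2, norm_neg] using (norm_sub_le_and_unique hyx (hK k hk)).1
  · rintro _ ⟨k, hk, rfl⟩ h
    have e1 : p + (x - y) - (p - y) = x := by abel
    have e2 : p + (x - y) - (p - k) = -(y - x - k) := by abel
    simp only [e1, e2, norm_neg] at h
    simp only [(norm_sub_le_and_unique hyx (hK k hk)).2 h]

/-- A proper closed convex set with nonempty interior contains a ball that touches a supporting
hyperplane of the set. -/
theorem exists_closedBall_subset_touching_halfspace [FiniteDimensional ℝ E] {C : Set E}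
    (hC : IsClosed C) (hconv : Convex ℝ C) (hint : (interior C).Nonempty) (hne : C ≠ Set.univ) :
    ∃ (c : E) (r : ℝ) (u : E), 0 < r ∧ ‖u‖ = 1 ∧ Metric.closedBall c r ⊆ C ∧
      ∀ z ∈ C, inner ℝ u z ≤ inner ℝ u c + r := by
  have : ProperSpace E := FiniteDimensional.proper_real E
  obtain ⟨c, hc⟩ := hint
  have hne' : (closure Cᶜ).Nonempty := (Set.nonempty_compl.2 hne).closure
  -- The ball around `c` reaching to the nearest point `a` of the closed complement lies in `C`, and
  -- `a` admits a supporting hyperplane.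
  obtain ⟨a, ha, hra⟩ := isClosed_closure.exists_infDist_eq_dist hne' c
  have haint : a ∉ interior C := by rwa [closure_compl] at ha
  set r := dist c a with hr
  have hrpos : 0 < r := dist_pos.2 fun h => haint (h ▸ hc)
  have hball : Metric.ball c r ⊆ interior C := by
    intro z hz
    by_contra hz'
    have hz2 : z ∈ closure Cᶜ := by rwa [closure_compl]
    have := Metric.infDist_le_dist_of_mem (x := c) hz2
    rw [Metric.mem_ball, dist_comm] at hz
    linarith
  have hcball : Metric.closedBall c r ⊆ C := by
    rw [← closure_ball c hrpos.ne']
    exact hC.closure_subset_iff.2 (hball.trans interior_subset)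
  obtain ⟨f, hf⟩ := geometric_hahn_banach_open_point hconv.interior isOpen_interior haint
  have hfC : ∀ z ∈ C, f z ≤ f a := by
    intro z hz
    have hz' : z ∈ closure (interior C) := by
      rw [hconv.closure_interior_eq_closure_of_nonempty_interior ⟨c, hc⟩]
      exact subset_closure hz
    exact closure_minimal (fun w hw => (hf w hw).le) (isClosed_le f.continuous continuous_const) hz'
  set w := (InnerProductSpace.toDual ℝ E).symm f with hw
  have hwf : ∀ z, inner ℝ w z = f z := fun z => InnerProductSpace.toDual_symm_apply
  have hw0 : w ≠ 0 := by
    intro h0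
    have h1 := hf c hc
    rw [← hwf, ← hwf, h0, inner_zero_left, inner_zero_left] at h1
    exact lt_irrefl _ h1
  have hwn : 0 < ‖w‖ := norm_pos_iff.2 hw0
  refine ⟨c, r, ‖w‖⁻¹ • w, hrpos, by rw [norm_smul, norm_inv, norm_norm, inv_mul_cancel₀ hwn.ne'],
    hcball, fun z hz => ?_⟩
  have h1 : inner ℝ w z ≤ inner ℝ w c + ‖w‖ * r := by
    have h2 : inner ℝ w (a - c) ≤ ‖w‖ * ‖a - c‖ := real_inner_le_norm _ _
    rw [← dist_eq_norm, dist_comm, ← hr, inner_sub_right] at h2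
    have := hfC z hz
    rw [← hwf, ← hwf] at this
    linarith
  rw [real_inner_smul_left, real_inner_smul_left]
  calc ‖w‖⁻¹ * inner ℝ w z ≤ ‖w‖⁻¹ * (inner ℝ w c + ‖w‖ * r) := by gcongr
    _ = ‖w‖⁻¹ * inner ℝ w c + r := by field_simp

/-- Some normal of a proper closed convex lattice-like body does not have inner products of the
same sign with two orthogonal vectors of the cone. -/
theorem IsLatticeLike.exists_normal [FiniteDimensional ℝ E] {K C : Set E}
    (hcone : ∀ t : ℝ, 0 < t → ∀ x ∈ K, t • x ∈ K)
    (hC : IsClosed C) (hconv : Convex ℝ C) (hL : IsLatticeLike K C)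
    (hint : (interior C).Nonempty) (hne : C ≠ Set.univ) :
    ∃ u : E, u ≠ 0 ∧ ∀ x ∈ K, ∀ y ∈ K, (∀ k ∈ K, 0 ≤ inner ℝ k x) → (∀ k ∈ K, 0 ≤ inner ℝ k y) →
      inner ℝ x y = 0 → inner ℝ u x * inner ℝ u y ≤ 0 := by
  obtain ⟨c, r, u, hr, hu, hball, hsup⟩ :=
    exists_closedBall_subset_touching_halfspace hC hconv hint hne
  refine ⟨u, fun h => by simp [h] at hu, ?_⟩
  intro x hx y hy hKx hKy hxy
  by_contra! hpos
  set α := inner ℝ u x with hα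
  set β := inner ℝ u y with hβ
  have hα0 : α ≠ 0 := left_ne_zero_of_mul hpos.ne'
  have hβ0 : β ≠ 0 := right_ne_zero_of_mul hpos.ne'
  -- The weights make `d` orthogonal to `u`, because `α` and `β` have the same sign.
  set d := |β| • x - |α| • y with hd
  have hud : inner ℝ u d = 0 := by
    rw [hd, inner_sub_right, real_inner_smul_right, real_inner_smul_right, ← hα, ← hβ]
    rcases lt_or_gt_of_ne hα0 with h | h
    · rw [abs_of_neg h, abs_of_neg (neg_of_mul_pos_right hpos h.le)]; ring
    · rw [abs_of_pos h, abs_of_pos (pos_of_mul_pos_right hpos h.le)]; ring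
  obtain ⟨s, hs, hsr, hsd⟩ : ∃ s : ℝ, 0 < s ∧ s * ‖d‖ ≤ r ∧ s * ‖d‖ ^ 2 < r * (|α| * |β|) := by
    have hab : 0 < |α| * |β| := by positivity
    have hev : ∀ᶠ s in 𝓝[>] (0 : ℝ), s * ‖d‖ < r ∧ s * ‖d‖ ^ 2 < r * (|α| * |β|) := by
      refine nhdsWithin_le_nhds (Filter.Eventually.and ?_ ?_)
      · exact ContinuousAt.eventually_lt (by fun_prop) (by fun_prop) (by simpa using hr)
      · exact ContinuousAt.eventually_lt (by fun_prop) (by fun_prop) (by simpa using by positivity)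
    obtain ⟨s, h, hs⟩ := (hev.and self_mem_nhdsWithin).exists
    exact ⟨s, hs, h.1.le, h.2⟩
  -- The depth `r - ρ` is quadratic in `s`, yet large enough for both `c + ρ u` and `c + ρ u + s d`
  -- to stay in the ball.
  set ρ := r - (s * ‖d‖) ^ 2 / r with hρ
  have hsd2 : (s * ‖d‖) ^ 2 ≤ r ^ 2 := by gcongr
  have hρr : ρ ^ 2 + (s * ‖d‖) ^ 2 ≤ r ^ 2 := by
    have : ρ ^ 2 + (s * ‖d‖) ^ 2 = r ^ 2 - (s * ‖d‖) ^ 2 * (r ^ 2 - (s * ‖d‖) ^ 2) / r ^ 2 := by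
      rw [hρ]; field_simp; ring
    rw [this]
    have : 0 ≤ (s * ‖d‖) ^ 2 * (r ^ 2 - (s * ‖d‖) ^ 2) / r ^ 2 := by
      have := sub_nonneg.2 hsd2
      positivity
    linarith
  have hp : c + ρ • u ∈ C := by
    apply hball
    rw [Metric.mem_closedBall, dist_eq_norm, add_sub_cancel_left, norm_smul, hu, mul_one]
    exact abs_le_of_sq_le_sq (by nlinarith [sq_nonneg (s * ‖d‖)]) hr.le
  have hq : c + ρ • u + (s * |β|) • x - (s * |α|) • y ∈ C := by
    apply hball
    have e : c + ρ • u + (s * |β|) • x - (s * |α|) • y - c = ρ • u + s • d := by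
      rw [hd, smul_sub, smul_smul, smul_smul]; abel
    rw [Metric.mem_closedBall, dist_eq_norm, e]
    refine (pow_le_pow_iff_left₀ (norm_nonneg _) hr.le two_ne_zero).1 ?_
    rw [norm_add_sq_real, real_inner_smul_left, real_inner_smul_right, hud, norm_smul, norm_smul,
      hu, mul_one, mul_pow, Real.norm_eq_abs, Real.norm_eq_abs, sq_abs, sq_abs, ← mul_pow]
    linarith
  have hquot : s * (|α| * |β|) ≤ (s * ‖d‖) ^ 2 / r → False := by
    intro h
    rw [le_div_iff₀ hr] at h
    have : s * (s * ‖d‖ ^ 2) < s * (r * (|α| * |β|)) := by gcongr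
    nlinarith
  have huc : inner ℝ u (c + ρ • u) = inner ℝ u c + ρ := by
    rw [inner_add_right, real_inner_smul_right, real_inner_self_eq_norm_sq, hu]; ring
  have hsα : 0 < s * |α| := by positivity
  have hsβ : 0 < s * |β| := by positivity
  have hxy' : inner ℝ ((s * |β|) • x) ((s * |α|) • y) = 0 := by
    rw [real_inner_smul_left, real_inner_smul_right, hxy]; ring
  obtain ⟨h1, h2⟩ := hL _ hp _ (add_sub_assoc (c + ρ • u) _ _ ▸ hq)
  rw [coneInf_add_sub (hcone _ hsα y hy) hxy' fun k hk => by
    rw [real_inner_smul_right]; exact mul_nonneg hsβ.le (hKx k hk)] at h1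
  rw [coneSup_add_sub (hcone _ hsβ x hx) hxy' fun k hk => by
    rw [real_inner_smul_right]; exact mul_nonneg hsα.le (hKy k hk)] at h2
  have h1' := hsup _ h1
  have h2' := hsup _ h2
  rw [inner_sub_right, huc, real_inner_smul_right, ← hβ] at h1'
  rw [inner_add_right, huc, real_inner_smul_right, ← hα] at h2'
  apply hquot
  -- For negative signs the infimum gains `s |α| |β|` in direction `u`, for positive signs the
  -- supremum does; this linear gain exceeds the depth.
  rcases lt_or_gt_of_ne hα0 with h | h
  · rw [abs_of_neg (neg_of_mul_pos_right hpos h.le)]; linarith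
  · rw [abs_of_pos h]; linarith

end Projection

namespace EuclideanJordanAlgebra

variable {V : Type*} [NormedAddCommGroup V] [InnerProductSpace ℝ V] [FiniteDimensional ℝ V]
  [EuclideanJordanAlgebra V]

/-! ### Jordan identities and commuting multiplication operators -/

section Algebra

scoped instance (priority := 100) toNonUnitalNonAssocCommRing : NonUnitalNonAssocCommRing V where
  left_distrib x y z := by
    rw [mul_comm x, mul_comm x, mul_comm x, EuclideanJordanAlgebra.add_mul]
  right_distrib := EuclideanJordanAlgebra.add_mul
  zero_mul x := by simpa using EuclideanJordanAlgebra.smul_mul 0 x x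
  mul_zero x := by rw [mul_comm]; simpa using EuclideanJordanAlgebra.smul_mul 0 x x
  mul_comm := mul_comm

scoped instance (priority := 100) : IsScalarTower ℝ V V := ⟨EuclideanJordanAlgebra.smul_mul⟩

scoped instance (priority := 100) : SMulCommClass ℝ V V :=
  ⟨fun t x y => by
    simp only [smul_eq_mul]
    rw [mul_comm x (t • y), EuclideanJordanAlgebra.smul_mul, mul_comm y]⟩

scoped instance (priority := 100) : MulOneClass V where
  one_mul := EuclideanJordanAlgebra.one_mul
  mul_one x := by rw [mul_comm, EuclideanJordanAlgebra.one_mul]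

theorem inner_mul_left (x y z : V) : inner ℝ (x * y) z = inner ℝ y (x * z) := inner_mul x y z

theorem inner_mul_right (x y z : V) : inner ℝ (x * y) z = inner ℝ x (y * z) := by
  rw [mul_comm, inner_mul_left]

/-- The linearized Jordan identity. -/
theorem linearized_jordan (a b c d : V) :
    a * ((b * c) * d) + b * ((c * a) * d) + c * ((a * b) * d) =
      (b * c) * (a * d) + (c * a) * (b * d) + (a * b) * (c * d) := by
  have h := DFunLike.congr_fun (two_nsmul_lie_lmul_lmul_add_add_eq_zero a b c) d
  have h2 : (2 : ℝ) • ((a * ((b * c) * d) - (b * c) * (a * d)) +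
      (b * ((c * a) * d) - (c * a) * (b * d)) + (c * ((a * b) * d) - (a * b) * (c * d))) = 0 := by
    rw [two_smul, ← two_nsmul]; exact h
  have h3 := (smul_eq_zero.1 h2).resolve_left two_ne_zero
  rw [← sub_eq_zero, ← h3]
  abel

/-- The linearized Jordan identity read as an operator identity in `a`. It reduces multiplication by
a triple product to multiplications by shorter products, which drives the induction on powers. -/
theorem mulLeft_mul_mul (b c d : V) : LinearMap.mulLeft ℝ ((b * c) * d) =
    LinearMap.mulLeft ℝ (b * c) * LinearMap.mulLeft ℝ d +
    LinearMap.mulLeft ℝ (b * d) * LinearMap.mulLeft ℝ c +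
    LinearMap.mulLeft ℝ (c * d) * LinearMap.mulLeft ℝ b -
    LinearMap.mulLeft ℝ b * (LinearMap.mulLeft ℝ d * LinearMap.mulLeft ℝ c) -
    LinearMap.mulLeft ℝ c * (LinearMap.mulLeft ℝ d * LinearMap.mulLeft ℝ b) := by
  ext a
  have h := linearized_jordan a b c d
  simp only [LinearMap.sub_apply, LinearMap.add_apply, Module.End.mul_apply,
    LinearMap.mulLeft_apply]
  rw [mul_comm a ((b * c) * d), mul_comm (c * a) d, mul_comm (a * b) d, mul_comm a d,
    mul_comm (c * a) (b * d), mul_comm (a * b) (c * d), mul_comm a b] at h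
  rw [eq_sub_iff_add_eq, eq_sub_iff_add_eq, ← h]
  abel

theorem commute_mulLeft_power (x : V) (n : ℕ) :
    Commute (LinearMap.mulLeft ℝ (power x n)) (LinearMap.mulLeft ℝ x) := by
  have hsq : Commute (LinearMap.mulLeft ℝ (x * x)) (LinearMap.mulLeft ℝ x) := by
    ext y
    exact IsJordan.lmul_lmul_comm_lmul x y
  have h01 : LinearMap.mulLeft ℝ (power x 0) = 1 := by
    ext y; exact EuclideanJordanAlgebra.one_mul y
  have h1 : power x 1 = x := by simp [power]
  suffices ∀ n, (Commute (LinearMap.mulLeft ℝ (power x n)) (LinearMap.mulLeft ℝ x)) ∧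
      Commute (LinearMap.mulLeft ℝ (power x (n + 1))) (LinearMap.mulLeft ℝ x) from (this n).1
  intro n
  induction n with
  | zero => exact ⟨h01 ▸ Commute.one_left _, by rw [h1]⟩
  | succ n ih =>
    refine ⟨ih.2, ?_⟩
    have e : power x (n + 1 + 1) = (x * power x n) * x := by rw [mul_comm]; rfl
    rw [e, mulLeft_mul_mul]
    have hx := Commute.refl (LinearMap.mulLeft ℝ x)
    have h2 : Commute (LinearMap.mulLeft ℝ (x * power x n)) (LinearMap.mulLeft ℝ x) := ih.2
    have h3 : Commute (LinearMap.mulLeft ℝ (power x n * x)) (LinearMap.mulLeft ℝ x) := by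
      rw [mul_comm]; exact ih.2
    exact ((((h2.mul_left hx).add_left (hsq.mul_left ih.1)).add_left (h3.mul_left hx)).sub_left
      (hx.mul_left (hx.mul_left ih.1))).sub_left (ih.1.mul_left (hx.mul_left hx))

end Algebra

/-! ### Spectral theorem -/

section Spectral

theorem isSymmetric_mulLeft (x : V) : (LinearMap.mulLeft ℝ x).IsSymmetric :=
  fun y z => inner_mul_left x y z

/-- A complete system of orthogonal idempotents, indexed by real numbers. -/
structure IsSpectralSystem (s : Finset ℝ) (c : ℝ → V) : Prop where
  eq_zero : ∀ μ ∉ s, c μ = 0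
  idem : ∀ μ, c μ * c μ = c μ
  orth : ∀ μ ν, μ ≠ ν → c μ * c ν = 0
  sum_eq : ∑ μ ∈ s, c μ = 1

/-- The spectral theorem. -/
theorem exists_spectralSystem (x : V) :
    ∃ (s : Finset ℝ) (c : ℝ → V), IsSpectralSystem s c ∧ x = ∑ μ ∈ s, μ • c μ := by
  set T := LinearMap.mulLeft ℝ x with hT
  set A := Submodule.span ℝ (Set.range (power x)) with hA
  have hTA : ∀ y ∈ A, T y ∈ A := by
    intro y hy
    have : A ≤ A.comap T := Submodule.span_le.2 (by
      rintro _ ⟨n, rfl⟩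
      exact Submodule.subset_span ⟨n + 1, rfl⟩)
    exact this hy
  -- Multiplication by `x` commutes with multiplication by any polynomial in `x`; this replaces
  -- associativity below.
  have hcomm : ∀ y ∈ A, ∀ z, x * (y * z) = y * (x * z) := by
    intro y hy z
    induction hy using Submodule.span_induction with
    | mem y hy =>
      obtain ⟨n, rfl⟩ := hy
      exact (DFunLike.congr_fun (commute_mulLeft_power x n) z).symm
    | zero => simp
    | add y w _ _ hy hw => rw [add_mul, mul_add, add_mul, hy, hw]
    | smul t y _ hy => rw [smul_mul_assoc, mul_smul_comm, smul_mul_assoc, hy]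
  have hsymm : (T.restrict hTA).IsSymmetric := (isSymmetric_mulLeft x).restrict_invariant hTA
  set b := hsymm.eigenvectorBasis rfl with hb
  set ev := hsymm.eigenvalues rfl with hev
  have hxb : ∀ i, x * (b i : V) = ev i • (b i : V) := by
    intro i
    exact congrArg Subtype.val (hsymm.apply_eigenvectorBasis rfl i)
  set one' : A := ⟨1, Submodule.subset_span ⟨0, rfl⟩⟩ with hone
  have hone_sum : (1 : V) = ∑ i, b.repr one' i • (b i : V) := by
    have := congrArg Subtype.val (b.sum_repr one')
    rw [Submodule.coe_sum] at this
    exact this.symm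
  -- The idempotents are the components of the unit in the eigenspaces of multiplication by `x` on
  -- the span of its powers.
  set c : ℝ → V := fun μ => ∑ i with ev i = μ, b.repr one' i • (b i : V) with hc
  set s : Finset ℝ := Finset.univ.image ev with hs
  have hcA : ∀ μ, c μ ∈ A := fun μ =>
    Submodule.sum_mem _ fun i _ => Submodule.smul_mem _ _ (b i).2
  have hsum : ∑ μ ∈ s, c μ = 1 := by
    rw [hone_sum]
    exact Finset.sum_fiberwise_of_maps_to (fun i hi => Finset.mem_image_of_mem _ hi) _
  have hxc : ∀ μ, x * c μ = μ • c μ := by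
    intro μ
    rw [hc, Finset.mul_sum, Finset.smul_sum]
    refine Finset.sum_congr rfl fun i hi => ?_
    rw [mul_smul_comm, hxb, (Finset.mem_filter.1 hi).2, smul_comm]
  -- The product is an eigenvector for both `μ` and `ν`, hence zero.
  have horth : ∀ μ ν, μ ≠ ν → c μ * c ν = 0 := by
    intro μ ν hne
    have h1 : x * (c μ * c ν) = ν • (c μ * c ν) := by rw [hcomm _ (hcA μ), hxc, mul_smul_comm]
    have h2 : x * (c μ * c ν) = μ • (c μ * c ν) := by
      rw [mul_comm (c μ), hcomm _ (hcA ν), hxc, mul_smul_comm]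
    have h3 : (μ - ν) • (c μ * c ν) = 0 := by rw [sub_smul, ← h1, ← h2, sub_self]
    exact (smul_eq_zero.1 h3).resolve_left (sub_ne_zero.2 hne)
  have hzero : ∀ μ ∉ s, c μ = 0 := by
    intro μ hμ
    refine Finset.sum_eq_zero fun i hi => absurd ?_ hμ
    exact Finset.mem_image.2 ⟨i, Finset.mem_univ _, (Finset.mem_filter.1 hi).2⟩
  refine ⟨s, c, ⟨hzero, fun μ => ?_, horth, hsum⟩, ?_⟩
  · by_cases hμ : μ ∈ s
    · conv_rhs => rw [← mul_one (c μ), ← hsum, Finset.mul_sum,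
        Finset.sum_eq_single_of_mem μ hμ fun ν _ hν => horth μ ν hν.symm]
    · rw [hzero μ hμ, mul_zero]
  · conv_lhs => rw [← mul_one x, ← hsum, Finset.mul_sum]
    exact Finset.sum_congr rfl fun μ _ => hxc μ

theorem IsSpectralSystem.sum_mul_sum {s : Finset ℝ} {c : ℝ → V} (h : IsSpectralSystem s c)
    (f g : ℝ → ℝ) :
    (∑ μ ∈ s, f μ • c μ) * (∑ μ ∈ s, g μ • c μ) = ∑ μ ∈ s, (f μ * g μ) • c μ := by
  rw [Finset.sum_mul]
  refine Finset.sum_congr rfl fun μ hμ => ?_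
  rw [Finset.mul_sum, Finset.sum_eq_single_of_mem μ hμ]
  · rw [smul_mul_assoc, mul_smul_comm, h.idem, smul_smul]
  · intro ν _ hν
    rw [smul_mul_assoc, mul_smul_comm, h.orth _ _ hν.symm, smul_zero, smul_zero]

theorem IsSpectralSystem.sum_mul {s : Finset ℝ} {c : ℝ → V} (h : IsSpectralSystem s c)
    (f : ℝ → ℝ) (ν : ℝ) : (∑ μ ∈ s, f μ • c μ) * c ν = f ν • c ν := by
  by_cases hν : ν ∈ s
  · rw [Finset.sum_mul, Finset.sum_eq_single_of_mem ν hν]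
    · rw [smul_mul_assoc, h.idem]
    · intro μ _ hμ
      rw [smul_mul_assoc, h.orth _ _ hμ, smul_zero]
  · rw [h.eq_zero ν hν, mul_zero, smul_zero]

theorem inner_eq_zero_of_mul_eq_zero {x y : V} (h : x * y = 0) : inner ℝ x y = 0 := by
  rw [← mul_one x, inner_mul_left, h, inner_zero_right]

end Spectral

/-! ### Peirce decomposition of an idempotent -/

section Peirce

variable {c : V}

theorem peirce_cubic (hc : c * c = c) (x : V) :
    c * (c * (c * x)) = (3 / 2 : ℝ) • (c * (c * x)) - (1 / 2 : ℝ) • (c * x) := by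
  have h := DFunLike.congr_fun (mulLeft_mul_mul c c c) x
  simp only [LinearMap.sub_apply, LinearMap.add_apply, Module.End.mul_apply,
    LinearMap.mulLeft_apply, hc] at h
  linear_combination (norm := module) (1 / 2 : ℝ) • h

/-- By the cubic equation the eigenvalues of multiplication by `c` are among 0, 1/2 and 1. The two
vectors on the right are the Peirce components of `x` for 1 and 1/2. -/
theorem peirce_quadratic (hc : c * c = c) (x : V) :
    inner ℝ (c * x) x = ‖(2 : ℝ) • (c * (c * x)) - c * x‖ ^ 2 +
      1 / 2 * ‖(4 : ℝ) • (c * x) - (4 : ℝ) • (c * (c * x))‖ ^ 2 := by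
  have h11 : inner ℝ (c * x) (c * x) = inner ℝ (c * (c * x)) x := (inner_mul_left c (c * x) x).symm
  have h12 : inner ℝ (c * (c * x)) (c * x) = inner ℝ (c * (c * (c * x))) x :=
    (inner_mul_left c (c * (c * x)) x).symm
  have h22 : inner ℝ (c * (c * x)) (c * (c * x)) = inner ℝ (c * (c * (c * x))) (c * x) :=
    (inner_mul_left c (c * (c * x)) (c * x)).symm
  rw [peirce_cubic hc, inner_sub_left, real_inner_smul_left, real_inner_smul_left] at h12 h22
  rw [h11] at h22
  simp only [← real_inner_self_eq_norm_sq, inner_sub_left, inner_sub_right, real_inner_smul_left,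
    real_inner_smul_right, real_inner_comm (c * (c * x)) (c * x)]
  rw [h11, h22, h12]
  ring

theorem inner_idem_mul_nonneg (hc : c * c = c) (x : V) : 0 ≤ inner ℝ (c * x) x := by
  rw [peirce_quadratic hc]; positivity

theorem mul_eq_zero_of_inner_idem_mul_eq_zero (hc : c * c = c) {x : V}
    (h : inner ℝ (c * x) x = 0) : c * x = 0 := by
  rw [peirce_quadratic hc] at h
  have h1 : (2 : ℝ) • (c * (c * x)) - c * x = 0 := by
    rw [← norm_eq_zero, ← sq_eq_zero_iff]; nlinarith [sq_nonneg ‖(2 : ℝ) • (c * (c * x)) - c * x‖,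
      sq_nonneg ‖(4 : ℝ) • (c * x) - (4 : ℝ) • (c * (c * x))‖]
  have h2 : (4 : ℝ) • (c * x) - (4 : ℝ) • (c * (c * x)) = 0 := by
    rw [← norm_eq_zero, ← sq_eq_zero_iff]; nlinarith [sq_nonneg ‖(2 : ℝ) • (c * (c * x)) - c * x‖,
      sq_nonneg ‖(4 : ℝ) • (c * x) - (4 : ℝ) • (c * (c * x))‖]
  calc c * x = ((2 : ℝ) • (c * (c * x)) - c * x) +
        (1 / 2 : ℝ) • ((4 : ℝ) • (c * x) - (4 : ℝ) • (c * (c * x))) := by module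
    _ = 0 := by rw [h1, h2]; simp

/-- The linearized Jordan identity at `c, c, x, y` collapses to `2 t - 1` times the difference of
the two sides. -/
theorem mul_left_comm_of_mul_eq_smul (hc : c * c = c) {x : V} {t : ℝ} (ht : t ≠ 1 / 2)
    (hx : c * x = t • x) (y : V) : c * (x * y) = x * (c * y) := by
  have h := linearized_jordan c c x y
  rw [mul_comm x c, hx, hc] at h
  simp only [smul_mul_assoc, mul_smul_comm] at h
  have h2 : (2 * t - 1) • (c * (x * y) - x * (c * y)) = 0 := by
    rw [← sub_eq_zero] at h
    rw [← h]; module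
  rcases smul_eq_zero.1 h2 with h3 | h3
  · exact absurd (by linarith) ht
  · exact sub_eq_zero.1 h3

theorem mul_left_comm_of_orthogonal (hc : c * c = c) {d : V} (h : c * d = 0) (y : V) :
    c * (d * y) = d * (c * y) :=
  mul_left_comm_of_mul_eq_smul hc (t := 0) (by norm_num) (by rw [h, zero_smul]) y

/-- The square of a vector of the half eigenspace has no half component, so it splits into parts for
1 and 0. -/
theorem mul_mul_self_of_half (hc : c * c = c) {v : V} (hv : c * v = (1 / 2 : ℝ) • v) :
    c * (c * (v * v)) = c * (v * v) := by
  have h := linearized_jordan c v v c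
  rw [mul_comm v c, hv] at h
  simp only [smul_mul_assoc, mul_smul_comm, mul_comm v c, hv, hc, mul_comm (v * v) c] at h
  rw [← sub_eq_zero] at h ⊢
  rw [← h]; module

/-- The half eigenspace of a nontrivial idempotent of a simple algebra is not zero. -/
theorem IsSimple.exists_half (hV : IsSimple V) (hc : c * c = c) (h0 : c ≠ 0) (h1 : c ≠ 1) :
    ∃ v : V, v ≠ 0 ∧ c * v = (1 / 2 : ℝ) • v := by
  by_contra! hno
  have hcc : ∀ x, c * (c * x) = c * x := by
    intro x
    by_contra hx
    refine hno (c * x - c * (c * x)) (sub_ne_zero.2 (Ne.symm hx)) ?_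
    rw [mul_sub, peirce_cubic hc]; module
  -- Without a half eigenspace the algebra is the sum of the eigenspaces for 1 and 0, and the former
  -- is an ideal.
  have hI := hV.2 (LinearMap.ker (LinearMap.mulLeft ℝ c - LinearMap.id)) (by
    intro x y hy
    simp only [LinearMap.mem_ker, LinearMap.sub_apply, LinearMap.mulLeft_apply, LinearMap.id_apply,
      sub_eq_zero] at hy ⊢
    have e1 := mul_left_comm_of_mul_eq_smul hc (x := c * x) (t := 1) (by norm_num)
      (by rw [hcc, one_smul]) y
    have e2 := mul_left_comm_of_mul_eq_smul hc (x := x - c * x) (t := 0) (by norm_num)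
      (by rw [mul_sub, hcc, sub_self, zero_smul]) y
    rw [hy] at e1 e2
    have e : x * y = c * x * y + (x - c * x) * y := by rw [← add_mul, add_sub_cancel]
    rw [e, mul_add, e1, e2])
  rcases hI with h | h
  · apply h0
    have : c ∈ LinearMap.ker (LinearMap.mulLeft ℝ c - LinearMap.id) := by simp [hc]
    rwa [h, Submodule.mem_bot] at this
  · apply h1
    have : (1 : V) ∈ LinearMap.ker (LinearMap.mulLeft ℝ c - LinearMap.id) := h ▸ Submodule.mem_top
    simpa [sub_eq_zero] using this

end Peirce

/-! ### Self-duality of the cone of squares and the strengthened sign condition -/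

section Cone

theorem smul_mem_squareCone {t : ℝ} (ht : 0 ≤ t) {x : V} (hx : x ∈ squareCone V) :
    t • x ∈ squareCone V := by
  obtain ⟨y, rfl⟩ := hx
  refine ⟨√t • y, ?_⟩
  simp only [smul_mul_assoc, mul_smul_comm, smul_smul, Real.mul_self_sqrt ht]

theorem IsSpectralSystem.sum_mem_squareCone {s : Finset ℝ} {c : ℝ → V} (h : IsSpectralSystem s c)
    {f : ℝ → ℝ} (hf : ∀ μ, 0 ≤ f μ) : ∑ μ ∈ s, f μ • c μ ∈ squareCone V := by
  refine ⟨∑ μ ∈ s, √(f μ) • c μ, ?_⟩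
  simp only [h.sum_mul_sum, Real.mul_self_sqrt (hf _)]

theorem inner_nonneg_of_mem_squareCone {x y : V} (hx : x ∈ squareCone V) (hy : y ∈ squareCone V) :
    0 ≤ inner ℝ x y := by
  obtain ⟨x, rfl⟩ := hx
  obtain ⟨y, rfl⟩ := hy
  obtain ⟨s, c, h, hy⟩ := exists_spectralSystem y
  simp only
  rw [hy, h.sum_mul_sum, inner_sum]
  refine Finset.sum_nonneg fun μ _ => ?_
  rw [real_inner_smul_right, inner_mul_right, real_inner_comm, mul_comm x]
  exact mul_nonneg (mul_self_nonneg μ) (inner_idem_mul_nonneg (h.idem μ) x)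

/-- The Moreau decomposition with respect to the cone of squares. -/
theorem exists_moreau (d : V) :
    ∃ x ∈ squareCone V, ∃ y ∈ squareCone V, inner ℝ x y = 0 ∧ d = x - y := by
  obtain ⟨s, c, h, hd⟩ := exists_spectralSystem d
  refine ⟨∑ μ ∈ s, μ⁺ • c μ, h.sum_mem_squareCone posPart_nonneg,
    ∑ μ ∈ s, μ⁻ • c μ, h.sum_mem_squareCone negPart_nonneg, ?_, ?_⟩
  · apply inner_eq_zero_of_mul_eq_zero
    rw [h.sum_mul_sum]
    refine Finset.sum_eq_zero fun μ _ => ?_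
    rcases le_total μ 0 with hμ | hμ
    · rw [posPart_of_nonpos hμ, zero_mul, zero_smul]
    · rw [negPart_of_nonneg hμ, mul_zero, zero_smul]
  · conv_lhs => rw [hd]
    rw [← Finset.sum_sub_distrib]
    exact Finset.sum_congr rfl fun μ _ => by rw [← sub_smul, posPart_sub_negPart]

/-- Rescale to `X`, `Y` with `⟪u, X⟫ = ⟪u, Y⟫` and decompose `X - Y = x' - y'`. Then `⟪u, x'⟫ = ⟪u,
y'⟫`, so the sign condition makes both vanish. Self-duality gives `‖X - x'‖ ^ 2 ≤ ⟪X, Y⟫`, and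
Cauchy–Schwarz for `u` and `X - x'` finishes. -/
theorem inner_mul_inner_le_of_orthogonal {u : V}
    (hu : ∀ x ∈ squareCone V, ∀ y ∈ squareCone V, inner ℝ x y = 0 →
      inner ℝ u x * inner ℝ u y ≤ 0) {x y : V} (hx : x ∈ squareCone V) (hy : y ∈ squareCone V) :
    inner ℝ u x * inner ℝ u y ≤ ‖u‖ ^ 2 * inner ℝ x y := by
  have hxy := inner_nonneg_of_mem_squareCone hx hy
  by_cases hpos : inner ℝ u x * inner ℝ u y ≤ 0
  · exact hpos.trans (by positivity)
  push Not at hpos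
  set α := inner ℝ u x with hα
  set β := inner ℝ u y with hβ
  have hX := smul_mem_squareCone (abs_nonneg β) hx
  have hY := smul_mem_squareCone (abs_nonneg α) hy
  set X := |β| • x with hXdef
  set Y := |α| • y with hYdef
  obtain ⟨x', hx', y', hy', horth, hd⟩ := exists_moreau (X - Y)
  have huX : inner ℝ u X = |β| * α := by rw [hXdef, real_inner_smul_right]
  have huY : inner ℝ u Y = |β| * α := by
    rw [hYdef, real_inner_smul_right, ← hβ]
    rcases lt_or_gt_of_ne (left_ne_zero_of_mul hpos.ne') with h | h
    · rw [abs_of_neg h, abs_of_neg (neg_of_mul_pos_right hpos h.le)]; ring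
    · rw [abs_of_pos h, abs_of_pos (pos_of_mul_pos_right hpos h.le)]; ring
  have heq : inner ℝ u x' = inner ℝ u y' := by
    rw [← sub_eq_zero, ← inner_sub_right, ← hd, inner_sub_right, huX, huY, sub_self]
  have hux' : inner ℝ u x' = 0 := by
    have := hu x' hx' y' hy' horth
    rw [← heq] at this
    exact mul_self_eq_zero.1 (le_antisymm this (mul_self_nonneg _))
  have hdist : ‖X - x'‖ ^ 2 ≤ inner ℝ X Y := by
    have e : X - x' = Y - y' := by
      rw [sub_eq_sub_iff_add_eq_add, ← sub_eq_zero]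
      calc X + y' - (Y + x') = (X - Y) - (x' - y') := by abel
        _ = 0 := by rw [hd, sub_self]
    have h1 : ‖X - x'‖ ^ 2 = inner ℝ (X - x') (Y - y') := by rw [← e, real_inner_self_eq_norm_sq]
    rw [h1, inner_sub_left, inner_sub_right, inner_sub_right, horth]
    have := inner_nonneg_of_mem_squareCone hX hy'
    have := inner_nonneg_of_mem_squareCone hx' hY
    linarith
  have hcs : (|β| * α) ^ 2 ≤ ‖u‖ ^ 2 * ‖X - x'‖ ^ 2 := by
    have h1 : inner ℝ u (X - x') = |β| * α := by rw [inner_sub_right, huX, hux', sub_zero]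
    rw [← h1, ← mul_pow]
    exact sq_le_sq' (neg_le_of_abs_le (abs_real_inner_le_norm _ _)) (real_inner_le_norm _ _)
  have hXY : inner ℝ X Y = (α * β) * inner ℝ x y := by
    rw [hXdef, hYdef, real_inner_smul_left, real_inner_smul_right, ← mul_assoc, ← abs_mul,
      mul_comm β, abs_of_pos hpos]
  have h2 : (α * β) * (α * β) ≤ (α * β) * (‖u‖ ^ 2 * inner ℝ x y) := by
    calc (α * β) * (α * β) = (|β| * α) ^ 2 := by rw [mul_pow, sq_abs]; ring
      _ ≤ ‖u‖ ^ 2 * ‖X - x'‖ ^ 2 := hcs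
      _ ≤ ‖u‖ ^ 2 * inner ℝ X Y := by gcongr
      _ = _ := by rw [hXY]; ring
  exact le_of_mul_le_mul_left h2 hpos

end Cone

/-! ### Structure of the normal and the bound on the rank -/

section Normal

/-- A triple of orthogonal idempotents with sum `1`. -/
structure IsOrthogonalTriple (p q f : V) : Prop where
  pp : p * p = p
  qq : q * q = q
  ff : f * f = f
  pq : p * q = 0
  pf : p * f = 0
  qf : q * f = 0
  sum_eq : p + q + f = 1

theorem IsOrthogonalTriple.swap {p q f : V} (h : IsOrthogonalTriple p q f) :
    IsOrthogonalTriple q p f :=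
  ⟨h.qq, h.pp, h.ff, by rw [mul_comm, h.pq], h.qf, h.pf, by rw [add_comm q, h.sum_eq]⟩

variable {u : V}

theorem inner_idem_mul_inner_idem_nonpos (hu : ∀ x ∈ squareCone V, ∀ y ∈ squareCone V,
    inner ℝ u x * inner ℝ u y ≤ ‖u‖ ^ 2 * inner ℝ x y) {c d : V} (hc : c * c = c) (hd : d * d = d)
    (hcd : c * d = 0) : inner ℝ u c * inner ℝ u d ≤ 0 := by
  have := hu c ⟨c, hc⟩ d ⟨d, hd⟩
  rwa [inner_eq_zero_of_mul_eq_zero hcd, mul_zero] at this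

theorem inner_idem_of_mul_eq_smul {c : V} {t : ℝ} (hc : c * c = c) (huc : u * c = t • c) :
    inner ℝ u c = t * ‖c‖ ^ 2 := by
  conv_lhs => rw [← hc]
  rw [← inner_mul_right, huc, real_inner_smul_left, real_inner_self_eq_norm_sq]

/-- The squares of `p + s w` and `f - s w` have inner product of order `s ^ 4`, since all lower
terms cancel. If `w ≠ 0`, the product of their inner products with `u` has order `s ^ 2`, which is
too large as `s` tends to 0. -/
theorem half_eq_zero (hu : ∀ x ∈ squareCone V, ∀ y ∈ squareCone V,
    inner ℝ u x * inner ℝ u y ≤ ‖u‖ ^ 2 * inner ℝ x y) {p q f w : V}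
    (h : IsOrthogonalTriple p q f) {a b : ℝ} (ha : a ≠ 0) (huab : u = a • p + b • q)
    (hpw : p * w = (1 / 2 : ℝ) • w) (hfw : f * w = (1 / 2 : ℝ) • w) : w = 0 := by
  by_contra hw
  have hqw : q * w = 0 := by
    have : (p + q + f) * w = w := by rw [h.sum_eq, one_mul]
    rw [add_mul, add_mul, hpw, hfw] at this
    linear_combination (norm := module) this
  have hp0 : p ≠ 0 := by
    rintro rfl
    rw [zero_mul] at hpw
    exact hw ((smul_eq_zero.1 hpw.symm).resolve_left (by norm_num))
  have ipw : inner ℝ p w = 0 := by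
    have : inner ℝ p (f * w) = 0 := by rw [← inner_mul_right, h.pf, inner_zero_left]
    rw [hfw, real_inner_smul_right] at this; linarith
  have ifw : inner ℝ f w = 0 := by
    have : inner ℝ f (p * w) = 0 := by rw [← inner_mul_right, mul_comm, h.pf, inner_zero_left]
    rw [hpw, real_inner_smul_right] at this; linarith
  have iqw : inner ℝ q w = 0 := by
    have : inner ℝ q (p * w) = 0 := by rw [← inner_mul_right, mul_comm, h.pq, inner_zero_left]
    rw [hpw, real_inner_smul_right] at this; linarith
  have ipww : inner ℝ p (w * w) = ‖w‖ ^ 2 / 2 := by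
    rw [← inner_mul_right, hpw, real_inner_smul_left, real_inner_self_eq_norm_sq]; ring
  have ifww : inner ℝ f (w * w) = ‖w‖ ^ 2 / 2 := by
    rw [← inner_mul_right, hfw, real_inner_smul_left, real_inner_self_eq_norm_sq]; ring
  have iqww : inner ℝ q (w * w) = 0 := by
    rw [← inner_mul_right, hqw, inner_zero_left]
  have ipf := inner_eq_zero_of_mul_eq_zero h.pf
  have ipq := inner_eq_zero_of_mul_eq_zero h.pq
  have iqf := inner_eq_zero_of_mul_eq_zero h.qf
  have key : ∀ s : ℝ, 0 < s →
      a ^ 2 * ‖p‖ ^ 2 * (‖w‖ ^ 2 / 2) ≤ s ^ 2 * (‖u‖ ^ 2 * ‖w * w‖ ^ 2) := by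
    intro s hs
    have hx : p + s • w + s ^ 2 • (w * w) ∈ squareCone V := by
      refine ⟨p + s • w, ?_⟩
      simp only [add_mul, mul_add, smul_mul_assoc, mul_smul_comm, h.pp, mul_comm w p, hpw]
      module
    have hy : f - s • w + s ^ 2 • (w * w) ∈ squareCone V := by
      refine ⟨f - s • w, ?_⟩
      simp only [sub_mul, mul_sub, smul_mul_assoc, mul_smul_comm, h.ff, mul_comm w f, hfw]
      module
    have hxy := hu _ hx _ hy
    have e1 : inner ℝ (p + s • w + s ^ 2 • (w * w)) (f - s • w + s ^ 2 • (w * w)) =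
        s ^ 4 * ‖w * w‖ ^ 2 := by
      simp only [inner_add_left, inner_add_right, inner_sub_right, real_inner_smul_left,
        real_inner_smul_right, ipf, ipw, ipww, real_inner_comm f w, ifw, real_inner_comm f (w * w),
        ifww, real_inner_comm w (w * w)]
      rw [real_inner_self_eq_norm_sq, real_inner_self_eq_norm_sq]
      ring
    have e2 : inner ℝ u (p + s • w + s ^ 2 • (w * w)) =
        a * ‖p‖ ^ 2 + s ^ 2 * (a * (‖w‖ ^ 2 / 2)) := by
      rw [huab]
      simp only [inner_add_left, inner_add_right, real_inner_smul_left,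
        real_inner_smul_right, ipw, ipww, iqw, iqww, real_inner_self_eq_norm_sq,
        real_inner_comm p q, ipq]
      ring
    have e3 : inner ℝ u (f - s • w + s ^ 2 • (w * w)) = s ^ 2 * (a * (‖w‖ ^ 2 / 2)) := by
      rw [huab]
      simp only [inner_add_left, inner_add_right, inner_sub_right, real_inner_smul_left,
        real_inner_smul_right, ipw, ipww, iqw, iqww, ipf, iqf]
      ring
    rw [e1, e2, e3] at hxy
    have hs2 : 0 < s ^ 2 := by positivity
    refine le_of_mul_le_mul_left ?_ hs2
    have : 0 ≤ (s ^ 2 * (a * (‖w‖ ^ 2 / 2))) ^ 2 := sq_nonneg _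
    nlinarith
  have hlim : Tendsto (fun s : ℝ => s ^ 2 * (‖u‖ ^ 2 * ‖w * w‖ ^ 2)) (𝓝[>] 0) (𝓝 0) := by
    refine Tendsto.mono_left ?_ nhdsWithin_le_nhds
    have : ContinuousAt (fun s : ℝ => s ^ 2 * (‖u‖ ^ 2 * ‖w * w‖ ^ 2)) 0 := by fun_prop
    simpa [ContinuousAt] using this
  have hle := ge_of_tendsto hlim (eventually_nhdsWithin_of_forall fun s hs => key s hs)
  have : 0 < a ^ 2 * ‖p‖ ^ 2 * (‖w‖ ^ 2 / 2) := by
    have := norm_pos_iff.2 hp0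
    have := norm_pos_iff.2 hw
    positivity
  linarith

/-- On the half space of `f` the idempotent `q` acts as `1/2 - p`. An eigenvalue `t` of `p` there
must have both `t` and `1/2 - t` in `{0, 1/2, 1}`, which excludes 1. -/
theorem IsOrthogonalTriple.mul_mul_half {p q f v : V} (h : IsOrthogonalTriple p q f)
    (hv : f * v = (1 / 2 : ℝ) • v) :
    p * (p * v) = (1 / 2 : ℝ) • (p * v) ∧ f * (p * v) = (1 / 2 : ℝ) • (p * v) := by
  have hfp : ∀ y, f * (p * y) = p * (f * y) :=
    mul_left_comm_of_orthogonal h.ff (by rw [mul_comm, h.pf])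
  have hq : ∀ y, q * y = y - p * y - f * y := by
    intro y
    have : (p + q + f) * y = y := by rw [h.sum_eq, one_mul]
    rw [add_mul, add_mul] at this
    linear_combination (norm := module) this
  have c1 := peirce_cubic h.pp v
  have c2 := peirce_cubic h.qq v
  simp only [hq, mul_sub, hfp, hv, mul_smul_comm] at c2
  refine ⟨?_, by rw [hfp, hv, mul_smul_comm]⟩
  linear_combination (norm := module) (-2 / 3 : ℝ) • c2 - (2 / 3 : ℝ) • c1

theorem IsOrthogonalTriple.eq_zero_of_isSimple (hV : IsSimple V)
    (hu : ∀ x ∈ squareCone V, ∀ y ∈ squareCone V,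
      inner ℝ u x * inner ℝ u y ≤ ‖u‖ ^ 2 * inner ℝ x y) {p q f : V}
    (h : IsOrthogonalTriple p q f) {a b : ℝ} (ha : a ≠ 0) (hb : b ≠ 0)
    (huab : u = a • p + b • q) (hf1 : f ≠ 1) : f = 0 := by
  by_contra hf0
  obtain ⟨v, hv0, hv⟩ := hV.exists_half h.ff hf0 hf1
  obtain ⟨h1, h2⟩ := h.mul_mul_half hv
  obtain ⟨h3, h4⟩ := h.swap.mul_mul_half hv
  have hp := half_eq_zero hu h ha huab h1 h2
  have hq := half_eq_zero hu h.swap hb (by rw [huab, add_comm]) h3 h4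
  have : (p + q + f) * v = v := by rw [h.sum_eq, one_mul]
  rw [add_mul, add_mul, hp, hq, hv] at this
  refine hv0 ((smul_eq_zero.1 (?_ : (1 / 2 : ℝ) • v = 0)).resolve_left (by norm_num))
  linear_combination (norm := module) -this

/-- Every spectral idempotent of `x` with nonzero eigenvalue lies under `p`. If it were neither 0
nor `p`, it and its complement in `p` would be orthogonal idempotents on which `u` has the sign of
`a`. -/
theorem IsOrthogonalTriple.mem_span_of_mul_eq_self (hu : ∀ x ∈ squareCone V, ∀ y ∈ squareCone V,
      inner ℝ u x * inner ℝ u y ≤ ‖u‖ ^ 2 * inner ℝ x y) {p q : V}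
    (h : IsOrthogonalTriple p q 0) {a b : ℝ} (ha : a ≠ 0) (huab : u = a • p + b • q)
    {x : V} (hx : p * x = x) : ∃ t : ℝ, x = t • p := by
  have hq : ∀ y, q * y = y - p * y := by
    intro y
    have : (p + q + 0) * y = y := by rw [h.sum_eq, one_mul]
    rw [add_mul, add_mul, zero_mul] at this
    linear_combination (norm := module) this
  have hqx : q * x = 0 := by rw [hq, hx, sub_self]
  have hinner : ∀ e, e * e = e → p * e = e → inner ℝ u e = a * ‖e‖ ^ 2 := by
    intro e he hpe
    apply inner_idem_of_mul_eq_smul he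
    rw [huab, add_mul, smul_mul_assoc, smul_mul_assoc, hpe, hq, hpe, sub_self, smul_zero, add_zero]
  obtain ⟨s, c, hs, hxs⟩ := exists_spectralSystem x
  have hnn : ∀ μ, 0 ≤ inner ℝ q (c μ) := fun μ => by
    have := inner_idem_mul_nonneg (hs.idem μ) q
    rwa [inner_mul_right, h.qq, real_inner_comm] at this
  have hsum : ∑ μ ∈ s, (μ * μ) * inner ℝ q (c μ) = 0 := by
    have : inner ℝ q (x * x) = 0 := by rw [← inner_mul_right, hqx, inner_zero_left]
    rw [hxs, hs.sum_mul_sum, inner_sum] at this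
    simpa only [real_inner_smul_right] using this
  have hqc : ∀ μ ∈ s, μ ≠ 0 → p * c μ = c μ := by
    intro μ hμ hμ0
    have h0 := (Finset.sum_eq_zero_iff_of_nonneg fun μ _ =>
      mul_nonneg (mul_self_nonneg μ) (hnn μ)).1 hsum μ hμ
    have h1 : inner ℝ (c μ * q) q = 0 := by
      rw [inner_mul_right, h.qq, real_inner_comm]
      exact (mul_eq_zero.1 h0).resolve_left (mul_self_ne_zero.2 hμ0)
    have h2 := mul_eq_zero_of_inner_idem_mul_eq_zero (hs.idem μ) h1
    rw [mul_comm, hq] at h2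
    exact (sub_eq_zero.1 h2).symm
  have hcp : ∀ μ ∈ s, μ ≠ 0 → c μ ≠ 0 → c μ = p := by
    intro μ hμ hμ0 hc0
    have hpc := hqc μ hμ hμ0
    have hcp : c μ * p = c μ := by rw [mul_comm, hpc]
    have hg : (p - c μ) * (p - c μ) = p - c μ := by
      rw [sub_mul, mul_sub, mul_sub, h.pp, hpc, hcp, hs.idem]; abel
    have hpg : p * (p - c μ) = p - c μ := by rw [mul_sub, h.pp, hpc]
    have hle := inner_idem_mul_inner_idem_nonpos hu (hs.idem μ) hg
      (by rw [mul_sub, hcp, hs.idem, sub_self])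
    rw [hinner _ (hs.idem μ) hpc, hinner _ hg hpg] at hle
    by_contra hne
    have h1 := norm_pos_iff.2 hc0
    have h2 := norm_pos_iff.2 (sub_ne_zero.2 (Ne.symm hne))
    have : 0 < a * ‖c μ‖ ^ 2 * (a * ‖p - c μ‖ ^ 2) := by
      have e : a * ‖c μ‖ ^ 2 * (a * ‖p - c μ‖ ^ 2) = a ^ 2 * ‖c μ‖ ^ 2 * ‖p - c μ‖ ^ 2 := by ring
      rw [e]; positivity
    linarith
  suffices x ∈ Submodule.span ℝ {p} by
    obtain ⟨t, ht⟩ := Submodule.mem_span_singleton.1 this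
    exact ⟨t, ht.symm⟩
  rw [hxs]
  refine Submodule.sum_mem _ fun μ hμ => ?_
  by_cases hμ0 : μ = 0
  · simp [hμ0]
  by_cases hc0 : c μ = 0
  · simp [hc0]
  exact Submodule.smul_mem _ _ (hcp μ hμ hμ0 hc0 ▸ Submodule.mem_span_singleton_self _)

theorem IsOrthogonalTriple.exists_mul_self_eq {p q : V} (h : IsOrthogonalTriple p q 0)
    (hp : ∀ x, p * x = x → ∃ t : ℝ, x = t • p) (hq : ∀ x, q * x = x → ∃ t : ℝ, x = t • q)
    (x : V) : ∃ s t : ℝ, x * x = s • x + t • 1 := by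
  have hqy : ∀ y, q * y = y - p * y := by
    intro y
    have : (p + q + 0) * y = y := by rw [h.sum_eq, one_mul]
    rw [add_mul, add_mul, zero_mul] at this
    linear_combination (norm := module) this
  have hsum : p + q = 1 := by rw [← h.sum_eq, add_zero]
  have half : ∀ v, p * v = (1 / 2 : ℝ) • v → ∃ t : ℝ, v * v = t • 1 := by
    intro v hpv
    have hqv : q * v = (1 / 2 : ℝ) • v := by rw [hqy, hpv]; module
    obtain ⟨α, hα⟩ := hp (p * (v * v)) (mul_mul_self_of_half h.pp hpv)
    obtain ⟨β, hβ⟩ := hq (q * (v * v)) (mul_mul_self_of_half h.qq hqv)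
    have hvv : v * v = α • p + β • q := by rw [← hα, ← hβ, hqy]; abel
    have iα : α * ‖p‖ ^ 2 = ‖v‖ ^ 2 / 2 := by
      have : inner ℝ p (v * v) = ‖v‖ ^ 2 / 2 := by
        rw [← inner_mul_right, hpv, real_inner_smul_left, real_inner_self_eq_norm_sq]; ring
      rw [← this, hvv, inner_add_right, real_inner_smul_right, real_inner_smul_right,
        inner_eq_zero_of_mul_eq_zero h.pq, real_inner_self_eq_norm_sq]; ring
    by_cases hv : v = 0
    · exact ⟨0, by simp [hv]⟩
    have hvpos := norm_pos_iff.2 hv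
    have hα0 : α ≠ 0 := by rintro rfl; rw [zero_mul] at iα; nlinarith [sq_pos_of_pos hvpos]
    have hp0 : p ≠ 0 := by rintro rfl; rw [norm_zero] at iα; nlinarith [sq_pos_of_pos hvpos]
    have hqp : q * p = 0 := by rw [mul_comm, h.pq]
    -- Comparing the `p` components of the two sides yields `α ^ 2 = α (α + β) / 2`, hence `α = β`.
    have hJ : (v * v) * (v * v) = v * (v * (v * v)) := IsCommJordan.lmul_comm_rmul_rmul v v
    have e1 : (v * v) * (v * v) = α ^ 2 • p + β ^ 2 • q := by
      rw [hvv]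
      simp only [add_mul, mul_add, smul_mul_assoc, mul_smul_comm, h.pp, h.qq, h.pq, hqp]
      module
    have e2 : v * (v * v) = ((α + β) / 2) • v := by
      conv_lhs => rw [hvv]
      rw [mul_add, mul_smul_comm, mul_smul_comm, mul_comm v p, mul_comm v q, hpv, hqv]
      module
    rw [e1, e2, mul_smul_comm, hvv] at hJ
    have h2 := congrArg (p * ·) hJ
    simp only [mul_add, mul_smul_comm, h.pp, h.pq, smul_zero, add_zero, smul_smul] at h2
    have h3 : (α ^ 2 - (α + β) / 2 * α) • p = 0 := by rw [sub_smul, h2, sub_self]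
    have h4 := (smul_eq_zero.1 h3).resolve_right hp0
    have h5 : α * (α - β) = 0 := by linarith
    have h6 : α = β := sub_eq_zero.1 ((mul_eq_zero.1 h5).resolve_left hα0)
    exact ⟨α, by rw [hvv, ← h6, ← smul_add, hsum]⟩
  -- The three vectors split `x` into its Peirce components for `p` with eigenvalues 1, 1/2 and 0.
  obtain ⟨a, ha⟩ := hp ((2 : ℝ) • (p * (p * x)) - p * x) (by
    rw [mul_sub, mul_smul_comm, peirce_cubic h.pp]; module)
  set v := (4 : ℝ) • (p * x) - (4 : ℝ) • (p * (p * x)) with hv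
  have hpv : p * v = (1 / 2 : ℝ) • v := by
    rw [hv, mul_sub, mul_smul_comm, mul_smul_comm, peirce_cubic h.pp]; module
  have hqv : q * v = (1 / 2 : ℝ) • v := by rw [hqy, hpv]; module
  obtain ⟨b, hb⟩ := hq (x - (3 : ℝ) • (p * x) + (2 : ℝ) • (p * (p * x))) (by
    rw [hqy, mul_add, mul_sub, mul_smul_comm, mul_smul_comm, peirce_cubic h.pp]; module)
  have hx : x = a • p + b • q + v := by rw [← ha, ← hb, hv]; module
  obtain ⟨t, ht⟩ := half v hpv
  have hqp : q * p = 0 := by rw [mul_comm, h.pq]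
  refine ⟨a + b, t - a * b, ?_⟩
  rw [hx]
  simp only [add_mul, mul_add, smul_mul_assoc, mul_smul_comm, h.pp, h.qq, h.pq, hqp,
    mul_comm v p, mul_comm v q, hpv, hqv, ht]
  rw [← hsum]
  module

theorem degree_le_two {x : V} {s t : ℝ} (h : x * x = s • x + t • 1) : degree x ≤ 2 := by
  refine Nat.sInf_le fun hli => ?_
  have h1 := Fintype.linearIndependent_iff.1 hli ![-t, -s, 1] (by
    simp [Fin.sum_univ_three, power, h]) 2
  simp at h1

theorem exists_orthogonalTriple (hu : ∀ x ∈ squareCone V, ∀ y ∈ squareCone V,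
      inner ℝ u x * inner ℝ u y ≤ ‖u‖ ^ 2 * inner ℝ x y) :
    ∃ (p q f : V) (a b : ℝ), IsOrthogonalTriple p q f ∧ a ≠ 0 ∧ b ≠ 0 ∧ u = a • p + b • q := by
  obtain ⟨s, c, hs, hus⟩ := exists_spectralSystem u
  have huc : ∀ μ, inner ℝ u (c μ) = μ * ‖c μ‖ ^ 2 := by
    intro μ
    apply inner_idem_of_mul_eq_smul (hs.idem μ)
    conv_lhs => rw [hus]
    exact hs.sum_mul id μ
  have hprod : ∀ μ ν, μ ≠ ν → 0 < μ * ν → c μ ≠ 0 → c ν = 0 := by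
    intro μ ν hne hpos hμ
    by_contra hν
    have h1 := inner_idem_mul_inner_idem_nonpos hu (hs.idem μ) (hs.idem ν) (hs.orth _ _ hne)
    rw [huc, huc] at h1
    have := norm_pos_iff.2 hμ
    have := norm_pos_iff.2 hν
    have h2 : 0 < (μ * ν) * (‖c μ‖ ^ 2 * ‖c ν‖ ^ 2) := by positivity
    linarith
  -- If no positive eigenvalue occurs, the default `a = 1` carries the idempotent 0 and keeps `a ≠
  -- 0`; `b = -1` plays this role for negative ones.
  obtain ⟨a, ha, hca⟩ : ∃ a : ℝ, 0 < a ∧ ∀ μ, 0 < μ → μ ≠ a → c μ = 0 := by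
    by_cases hex : ∃ a, 0 < a ∧ c a ≠ 0
    · obtain ⟨a, ha, hca⟩ := hex
      exact ⟨a, ha, fun μ hμ hne => hprod a μ hne.symm (mul_pos ha hμ) hca⟩
    · push Not at hex
      exact ⟨1, one_pos, fun μ hμ _ => hex μ hμ⟩
  obtain ⟨b, hb, hcb⟩ : ∃ b : ℝ, b < 0 ∧ ∀ μ, μ < 0 → μ ≠ b → c μ = 0 := by
    by_cases hex : ∃ b, b < 0 ∧ c b ≠ 0
    · obtain ⟨b, hb, hcb⟩ := hex
      exact ⟨b, hb, fun μ hμ hne => hprod b μ hne.symm (mul_pos_of_neg_of_neg hb hμ) hcb⟩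
    · push Not at hex
      exact ⟨-1, by norm_num, fun μ hμ _ => hex μ hμ⟩
  have hsupp : ∀ μ, μ ∉ ({a, b, 0} : Finset ℝ) → c μ = 0 := by
    intro μ hμ
    simp only [Finset.mem_insert, Finset.mem_singleton, not_or] at hμ
    rcases lt_or_gt_of_ne hμ.2.2 with h | h
    · exact hcb μ h hμ.2.1
    · exact hca μ h hμ.1
  have hsum : ∀ f : ℝ → ℝ, ∑ μ ∈ s, f μ • c μ = f a • c a + f b • c b + f 0 • c 0 := by
    intro f
    have e1 : ∑ μ ∈ s, f μ • c μ = ∑ μ ∈ s ∪ {a, b, 0}, f μ • c μ :=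
      Finset.sum_subset Finset.subset_union_left fun μ _ hμ => by rw [hs.eq_zero μ hμ, smul_zero]
    have e2 : ∑ μ ∈ ({a, b, 0} : Finset ℝ), f μ • c μ = ∑ μ ∈ s ∪ {a, b, 0}, f μ • c μ :=
      Finset.sum_subset Finset.subset_union_right fun μ _ hμ => by rw [hsupp μ hμ, smul_zero]
    rw [e1, ← e2, Finset.sum_insert, Finset.sum_insert, Finset.sum_singleton, add_assoc]
    · simpa using hb.ne
    · simp only [Finset.mem_insert, Finset.mem_singleton, not_or]
      exact ⟨(hb.trans ha).ne', ha.ne'⟩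
  refine ⟨c a, c b, c 0, a, b, ⟨hs.idem _, hs.idem _, hs.idem _, hs.orth _ _ (hb.trans ha).ne',
    hs.orth _ _ ha.ne', hs.orth _ _ hb.ne, ?_⟩, ha.ne', hb.ne, ?_⟩
  · rw [← hs.sum_eq]
    simpa using (hsum fun _ => 1).symm
  · rw [hus]
    simpa using hsum id

theorem rank_le_two_of_inner_mul_inner_le (hV : IsSimple V) (hu0 : u ≠ 0)
    (hu : ∀ x ∈ squareCone V, ∀ y ∈ squareCone V,
      inner ℝ u x * inner ℝ u y ≤ ‖u‖ ^ 2 * inner ℝ x y) : rank V ≤ 2 := by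
  obtain ⟨p, q, f, a, b, h, ha, hb, huab⟩ := exists_orthogonalTriple hu
  have hf1 : f ≠ 1 := by
    rintro rfl
    have hp := h.pf
    have hq := h.qf
    rw [mul_one] at hp hq
    exact hu0 (by rw [huab, hp, hq, smul_zero, smul_zero, add_zero])
  obtain rfl := h.eq_zero_of_isSimple hV hu ha hb huab hf1
  refine ciSup_le fun x => ?_
  obtain ⟨s, t, hst⟩ := h.exists_mul_self_eq (fun x => h.mem_span_of_mul_eq_self hu ha huab)
    (fun x => h.swap.mem_span_of_mul_eq_self hu hb (by rw [huab, add_comm])) x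
  exact degree_le_two hst

theorem not_exists_isLatticeLike (hV : IsSimple V) (hr : 3 ≤ rank V) :
    ¬ ∃ C : Set V, IsClosed C ∧ Convex ℝ C ∧ IsLatticeLike (squareCone V) C ∧
      (interior C).Nonempty ∧ C ≠ Set.univ := by
  rintro ⟨C, hC, hconv, hL, hint, hne⟩
  obtain ⟨u, hu0, hu⟩ := hL.exists_normal (fun t ht x hx => smul_mem_squareCone ht.le hx)
    hC hconv hint hne
  have := rank_le_two_of_inner_mul_inner_le hV hu0 fun x hx y hy =>
    inner_mul_inner_le_of_orthogonal (fun x hx y hy => hu x hx y hy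
      (fun k hk => inner_nonneg_of_mem_squareCone hk hx)
      (fun k hk => inner_nonneg_of_mem_squareCone hk hy)) hx hy
  omega

end Normal

end EuclideanJordanAlgebra

/-! ### Symmetric matrices -/

namespace SymmMatrix

variable {n : ℕ}

open Matrix

/-- The matrix `v vᵀ`. -/
def rankOne (v : Fin n → ℝ) : SymmMatrix n :=
  ⟨vecMulVec v v, by
    change (vecMulVec v v)ᵀ = vecMulVec v v
    rw [transpose_vecMulVec]⟩

theorem inner_rankOne (A : SymmMatrix n) (v : Fin n → ℝ) :
    inner ℝ A (rankOne v) = v ⬝ᵥ (A.toMatrix *ᵥ v) := by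
  change (A.toMatrix * vecMulVec v v).trace = _
  rw [mul_vecMulVec, trace_vecMulVec, dotProduct_comm]

theorem rankOne_mem_psdCone (v : Fin n → ℝ) : rankOne v ∈ psdCone n := by
  have := posSemidef_vecMulVec_self_star v
  rwa [star_trivial] at this

theorem inner_rankOne_rankOne (v w : Fin n → ℝ) :
    inner ℝ (rankOne v) (rankOne w) = (v ⬝ᵥ w) ^ 2 := by
  rw [inner_rankOne]
  change w ⬝ᵥ (vecMulVec v v *ᵥ w) = _
  rw [vecMulVec_mulVec, dotProduct_comm w, op_smul_eq_smul, smul_dotProduct, smul_eq_mul, sq]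

theorem inner_rankOne_nonneg {A : SymmMatrix n} (hA : A ∈ psdCone n) (v : Fin n → ℝ) :
    0 ≤ inner ℝ A (rankOne v) := by
  rw [inner_rankOne]
  simpa using (posSemidef_iff_dotProduct_mulVec.1 hA).2 v

theorem smul_mem_psdCone {t : ℝ} (ht : 0 < t) {A : SymmMatrix n} (hA : A ∈ psdCone n) :
    t • A ∈ psdCone n :=
  PosSemidef.smul (show A.toMatrix.PosSemidef from hA) ht.le

/-- Orthonormal eigenvectors show that distinct eigenvalues have nonpositive products, and their
sums and differences show that one nonzero eigenvalue makes all nonzero. Three nonzero reals cannot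
have pairwise opposite signs. -/
theorem eq_zero_of_orthogonal {U : SymmMatrix n} (hn : 3 ≤ n)
    (hU : ∀ v w : Fin n → ℝ, v ⬝ᵥ w = 0 →
      (v ⬝ᵥ (U.toMatrix *ᵥ v)) * (w ⬝ᵥ (U.toMatrix *ᵥ w)) ≤ 0) : U = 0 := by
  have hH : U.toMatrix.IsHermitian := by
    rw [IsHermitian, conjTranspose_eq_transpose_of_trivial]; exact U.2
  set ev := hH.eigenvalues with hev
  set b : Fin n → Fin n → ℝ := fun i => ⇑(hH.eigenvectorBasis i) with hb
  have hUb : ∀ i, U.toMatrix *ᵥ b i = ev i • b i := hH.mulVec_eigenvectorBasis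
  have hbb : ∀ i j, b i ⬝ᵥ b j = if i = j then 1 else 0 := by
    intro i j
    have := orthonormal_iff_ite.1 hH.eigenvectorBasis.orthonormal i j
    rw [EuclideanSpace.inner_eq_star_dotProduct, star_trivial, dotProduct_comm] at this
    exact this
  have hq : ∀ i, b i ⬝ᵥ (U.toMatrix *ᵥ b i) = ev i := by
    intro i
    rw [hUb, dotProduct_smul, hbb, if_pos rfl, smul_eq_mul, mul_one]
  have hprod : ∀ i j, i ≠ j → ev i * ev j ≤ 0 := by
    intro i j hij
    have := hU (b i) (b j) (by rw [hbb, if_neg hij])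
    rwa [hq, hq] at this
  have hnz : ∀ i j, i ≠ j → ev i ≠ 0 → ev j ≠ 0 := by
    intro i j hij hi hj
    -- Both factors equal `ev i + ev j`, so with `ev j = 0` the inequality says that `ev i` squared
    -- is at most 0.
    have h := hU (b i + b j) (b i - b j) (by
      simp [hbb, hij, hij.symm])
    simp [mulVec_add, mulVec_sub, hUb, hbb, hij.symm, hj] at h
    exact hi (mul_self_eq_zero.1 (le_antisymm h (mul_self_nonneg _)))
  have hev0 : ev = 0 := by
    by_contra hne
    obtain ⟨i, hi⟩ := Function.ne_iff.1 hne
    have hall : ∀ j, ev j ≠ 0 := by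
      intro j
      by_cases hij : i = j
      · exact hij ▸ hi
      · exact hnz i j hij hi
    have h01 := hprod ⟨0, by omega⟩ ⟨1, by omega⟩ (by simp)
    have h02 := hprod ⟨0, by omega⟩ ⟨2, by omega⟩ (by simp)
    have h12 := hprod ⟨1, by omega⟩ ⟨2, by omega⟩ (by simp)
    have h0 := hall ⟨0, by omega⟩
    have h1 := hall ⟨1, by omega⟩
    have h2 := hall ⟨2, by omega⟩
    rcases lt_or_gt_of_ne h0 with h0 | h0 <;> rcases lt_or_gt_of_ne h1 with h1 | h1 <;>
      rcases lt_or_gt_of_ne h2 with h2 | h2 <;> nlinarith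
  exact Subtype.ext (hH.eigenvalues_eq_zero_iff.1 hev0)

theorem not_exists_isLatticeLike (hn : 3 ≤ n) :
    ¬ ∃ C : Set (SymmMatrix n), IsClosed C ∧ Convex ℝ C ∧ IsLatticeLike (psdCone n) C ∧
      (interior C).Nonempty ∧ C ≠ Set.univ := by
  rintro ⟨C, hC, hconv, hL, hint, hne⟩
  have : FiniteDimensional ℝ (SymmMatrix n) :=
    inferInstanceAs (FiniteDimensional ℝ (symmSubmodule n))
  obtain ⟨U, hU0, hU⟩ := hL.exists_normal (fun t ht A hA => smul_mem_psdCone ht hA)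
    hC hconv hint hne
  refine hU0 (eq_zero_of_orthogonal hn fun v w hvw => ?_)
  rw [← inner_rankOne, ← inner_rankOne]
  exact hU _ (rankOne_mem_psdCone v) _ (rankOne_mem_psdCone w)
    (fun A hA => inner_rankOne_nonneg hA v) (fun A hA => inner_rankOne_nonneg hA w)
    (by rw [inner_rankOne_rankOne, hvw]; norm_num)

end SymmMatrix

end

theorem mainTheorem2 :
    (∀ (V : Type*) [NormedAddCommGroup V] [InnerProductSpace ℝ V] [FiniteDimensional ℝ V]
      [EuclideanJordanAlgebra V],
      EuclideanJordanAlgebra.IsSimple V → 3 ≤ EuclideanJordanAlgebra.rank V →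
        ¬ ∃ C : Set V, IsClosed C ∧ Convex ℝ C ∧
          IsLatticeLike (EuclideanJordanAlgebra.squareCone V) C ∧
          (interior C).Nonempty ∧ C ≠ Set.univ) ∧
    (∀ n : ℕ, 3 ≤ n →
      ¬ ∃ C : Set (SymmMatrix n), IsClosed C ∧ Convex ℝ C ∧
        IsLatticeLike (SymmMatrix.psdCone n) C ∧
        (interior C).Nonempty ∧ C ≠ Set.univ) := by
  exact ⟨fun _ _ _ _ _ hV hr => EuclideanJordanAlgebra.not_exists_isLatticeLike hV hr,
    fun _ hn => SymmMatrix.not_exists_isLatticeLike hn⟩
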